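/- Let $\xi:E\to B$ be a locally trivial real vector bundle of finite rank over a topological space $B$, equipped with a continuous scalar product on its fibres. Let $\dot E\subset E$ be the space of unit vectors, with the projection $\dot\xi:\dot E\to B$. Let $\ddot E$ be the space of pairs $(e,e')\in\dot E\times\dot E$ with $\xi(e)=\xi(e')$ and $e\perp e'$, with the projection $\ddot\xi:\ddot E\to\dot E$, $\ddot\xi(e,e')=e$. For a continuous map $p:X\to Y$ let $\mathsf{secat}[p]\in\{0,1,2,\dots,\infty\}$ be the smallest $k$ such that $Y$ has an open cover $U_0\cup U_1\cup\dots\cup U_k=Y$ with a continuous section of $p$ over each $U_i$ (and $\infty$ if there is no such $k$). For $r\ge 2$ and fixed points $0\le t_1<t_2<\dots<t_r\le 1$ of $I=[0,1]$, let $\mathsf{TC}_r[p:X\to Y]:=\mathsf{secat}[\Pi_r]$, where $$\Pi_r:X^I_Y\to X^r_Y,\qquad \Pi_r(\alpha)=(\alpha(t_1),\dots,\alpha(t_r)).$$ Here $X^I_Y$ is the space, with the compact-open topology, of continuous paths $\alpha:I\to X$ such that $p\circ\alpha$ is constant, and $X^r_Y=\{(x_1,\dots,x_r)\in X^r:\ p(x_1)=\dots=p(x_r)\}$.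 Then for every $r\ge 2$ and every choice of the points $t_1<\dots<t_r$, $$\mathsf{TC}_r[\dot\xi:\dot E\to B]\ \le\ \mathsf{secat}[\ddot\xi:\ddot E\to\dot E]+r-1.$$ -/

import Mathlib

open Bundle

/-- The map `p : X → Y` admits a continuous section over the subset `U` of `Y`. -/
def HasSectionOver {X Y : Type*} [TopologicalSpace X] [TopologicalSpace Y]
    (p : X → Y) (U : Set Y) : Prop :=
  ∃ s : C(U, X), ∀ u : U, p (s u) = (u : Y)

/-- The (reduced) sectional category of `p : X → Y`: the least `k` such that `Y` has an open cover
`U 0, …, U k` with a continuous section of `p` over every `U i`; it is `⊤` if there is no such `k`. -/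
noncomputable def secat {X Y : Type*} [TopologicalSpace X] [TopologicalSpace Y]
    (p : X → Y) : ℕ∞ :=
  sInf {n : ℕ∞ | ∃ k : ℕ, n = (k : ℕ∞) ∧ ∃ U : Fin (k + 1) → Set Y,
    (∀ i, IsOpen (U i)) ∧ (⋃ i, U i) = Set.univ ∧ ∀ i, HasSectionOver p (U i)}

/-- The `r`-fold fibre power of `p : X → Y`, with the subspace topology of the product `X ^ r`. -/
abbrev FiberPower {X Y : Type*} (p : X → Y) (r : ℕ) : Type _ :=
  {e : Fin r → X // ∀ i j, p (e i) = p (e j)}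

/-- The space of continuous paths `α : [0,1] → X` for which `p ∘ α` is constant, with the
compact-open topology. -/
abbrev FiberPath {X Y : Type*} [TopologicalSpace X] (p : X → Y) : Type _ :=
  {α : C(unitInterval, X) // ∀ a b, p (α a) = p (α b)}

/-- The evaluation map `α ↦ (α (t 0), …, α (t (r - 1)))` from the space of paths lying in a
fibre of `p` to the `r`-fold fibre power of `p`. -/
def evalAtTimes {X Y : Type*} [TopologicalSpace X] (p : X → Y) {r : ℕ}
    (t : Fin r → unitInterval) : FiberPath p → FiberPower p r :=
  fun α => ⟨fun i => α.1 (t i), fun i j => α.2 (t i) (t j)⟩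

/-- The `r`-th sequential parametrized topological complexity of `p`, computed with the time
schedule `t`: the sectional category of the evaluation map at the times `t 0 < … < t (r - 1)`. -/
noncomputable def sequentialParamTC {X Y : Type*} [TopologicalSpace X]
    (p : X → Y) {r : ℕ} (t : Fin r → unitInterval) : ℕ∞ :=
  secat (evalAtTimes p t)

section SphereBundles

variable {B : Type*} (F : Type*) (V : B → Type*) [∀ b, NormedAddCommGroup (V b)]

/-- The total space of the unit sphere bundle of a bundle of normed spaces `V`. -/
abbrev UnitSphereBundle : Type _ :=
  {e : TotalSpace F V // ‖e.snd‖ = 1}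

/-- The projection of the unit sphere bundle to the base. -/
def unitSphereProj : UnitSphereBundle F V → B :=
  fun e => e.1.proj

/-- The total space of the Stiefel bundle of orthonormal 2-frames: the pairs of unit vectors that
lie in one fibre `V b` and are orthogonal there, with the subspace topology of the product. -/
abbrev StiefelBundle [∀ b, InnerProductSpace ℝ (V b)] : Type _ :=
  {z : UnitSphereBundle F V × UnitSphereBundle F V //
    ∃ (b : B) (v w : V b), z.1.1 = ⟨b, v⟩ ∧ z.2.1 = ⟨b, w⟩ ∧ inner ℝ v w = 0}

/-- The projection `(e, e') ↦ e` of the Stiefel bundle to the unit sphere bundle. -/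
def stiefelProj [∀ b, InnerProductSpace ℝ (V b)] : StiefelBundle F V → UnitSphereBundle F V :=
  fun z => z.1.1

end SphereBundles

open Topology

/-! ### Sectional category: gluing sections over disjoint open sets, and optimal covers. -/

section Secat

variable {X Y : Type*} [TopologicalSpace X] [TopologicalSpace Y] {p : X → Y}

/-! Let `x` be the first of `r` unit vectors in one fibre, and `y j` the others. The segment from
`x` to `y j` misses 0 unless `y j = -x`. If `y j ≠ x` and a unit vector `σ ⊥ x` is given, the detour
from `x` past `σ` to `-x` and on to `y j` misses 0. A path based at `x` that visits each `y j`
around its time, once normalized, solves the problem (`tour_ne_zero`). It depends continuously on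
the data wherever `σ` does and the set `J` of detoured indices is fixed
(`hasSectionOver_evalAtTimes_of_tour`).

Here `σ` comes from one of `k + 1` open sets `U i`, and `J` has at most `r - 1` elements, as `x`
itself needs no detour. To avoid about `(k + 1) * r` sets, `secat_le_of_smallValuesSet` gives each
`i` its own window of thresholds for `1 + ⟨x, y j⟩`. Pieces with equal `i + |J|` are then disjoint
and merge, and this sum takes only `k + r` values. -/

theorem HasSectionOver.iUnion_of_pairwise_disjoint {ι : Type*} {S : ι → Set Y}
    (hopen : ∀ a, IsOpen (S a)) (hdisj : Pairwise (Function.onFun Disjoint S))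
    (hS : ∀ a, HasSectionOver p (S a)) : HasSectionOver p (⋃ a, S a) := by
  choose s hs using hS
  let T : ι → Set (⋃ a, S a : Set Y) := fun a => Subtype.val ⁻¹' S a
  let φ : ∀ a, C(T a, X) := fun a =>
    (s a).comp ⟨fun u => ⟨u.1.1, u.2⟩, by fun_prop⟩
  have hφ : ∀ (a b : ι) (x : (⋃ a, S a : Set Y)) (ha : x ∈ T a) (hb : x ∈ T b),
      φ a ⟨x, ha⟩ = φ b ⟨x, hb⟩ := by
    intro a b x ha hb
    obtain rfl : a = b := by
      by_contra hab
      exact Set.disjoint_left.1 (hdisj hab) ha hb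
    rfl
  have hT : ∀ x : (⋃ a, S a : Set Y), ∃ a, T a ∈ 𝓝 x := by
    intro x
    obtain ⟨a, ha⟩ := Set.mem_iUnion.1 x.2
    exact ⟨a, ((hopen a).preimage continuous_subtype_val).mem_nhds ha⟩
  refine ⟨ContinuousMap.liftCover T φ hφ hT, fun u => ?_⟩
  obtain ⟨a, ha⟩ := Set.mem_iUnion.1 u.2
  have h : ContinuousMap.liftCover T φ hφ hT u = φ a ⟨u, ha⟩ :=
    ContinuousMap.liftCover_coe (⟨u, ha⟩ : T a)
  rw [h]
  exact hs a ⟨u.1, ha⟩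

theorem secat_le_of_cover {k : ℕ} (U : Fin (k + 1) → Set Y) (hopen : ∀ i, IsOpen (U i))
    (hcov : (⋃ i, U i) = Set.univ) (hsec : ∀ i, HasSectionOver p (U i)) :
    secat p ≤ (k : ℕ∞) :=
  sInf_le ⟨k, rfl, U, hopen, hcov, hsec⟩

theorem exists_cover_of_secat_ne_top (h : secat p ≠ ⊤) :
    ∃ k : ℕ, secat p = (k : ℕ∞) ∧ ∃ U : Fin (k + 1) → Set Y,
      (∀ i, IsOpen (U i)) ∧ (⋃ i, U i) = Set.univ ∧ ∀ i, HasSectionOver p (U i) := by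
  refine csInf_mem (s := {n : ℕ∞ | ∃ k : ℕ, n = (k : ℕ∞) ∧ ∃ U : Fin (k + 1) → Set Y,
    (∀ i, IsOpen (U i)) ∧ (⋃ i, U i) = Set.univ ∧ ∀ i, HasSectionOver p (U i)})
    (Set.nonempty_iff_ne_empty.2 fun he => h ?_)
  rw [secat, he, sInf_empty]

end Secat

/-! ### Continuity of fibrewise linear operations in a vector bundle. -/

section BundleContinuity

variable {B F X : Type*} {V : B → Type*} [TopologicalSpace B] [TopologicalSpace X]
  [NormedAddCommGroup F] [NormedSpace ℝ F] [TopologicalSpace (TotalSpace F V)]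
  [∀ b, AddCommGroup (V b)] [∀ b, Module ℝ (V b)] [∀ b, TopologicalSpace (V b)]
  [FiberBundle F V] [VectorBundle ℝ F V] {b : X → B}

/-- The local trivialization at `b x` is linear on all nearby fibres, so addition can be checked in
`F`. -/
theorem Continuous.add_totalSpace {v w : ∀ x, V (b x)}
    (hv : Continuous fun x => TotalSpace.mk' F (b x) (v x))
    (hw : Continuous fun x => TotalSpace.mk' F (b x) (w x)) :
    Continuous fun x => TotalSpace.mk' F (b x) (v x + w x) := by
  rw [continuous_iff_continuousAt] at *
  intro x
  have h1 := (FiberBundle.continuousAt_totalSpace F _).1 (hv x)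
  have h2 := (FiberBundle.continuousAt_totalSpace F _).1 (hw x)
  refine (FiberBundle.continuousAt_totalSpace F _).2 ⟨h1.1, (h1.2.add h2.2).congr ?_⟩
  filter_upwards [h1.1.preimage_mem_nhds ((trivializationAt F V (b x)).open_baseSet.mem_nhds
    (FiberBundle.mem_baseSet_trivializationAt F V (b x)))] with y hy
  exact (((trivializationAt F V (b x)).linear ℝ hy).map_add (v y) (w y)).symm

theorem Continuous.smul_totalSpace {v : ∀ x, V (b x)} {c : X → ℝ} (hc : Continuous c)
    (hv : Continuous fun x => TotalSpace.mk' F (b x) (v x)) :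
    Continuous fun x => TotalSpace.mk' F (b x) (c x • v x) := by
  rw [continuous_iff_continuousAt] at *
  intro x
  have h1 := (FiberBundle.continuousAt_totalSpace F _).1 (hv x)
  refine (FiberBundle.continuousAt_totalSpace F _).2 ⟨h1.1, ((hc x).smul h1.2).congr ?_⟩
  filter_upwards [h1.1.preimage_mem_nhds ((trivializationAt F V (b x)).open_baseSet.mem_nhds
    (FiberBundle.mem_baseSet_trivializationAt F V (b x)))] with y hy
  exact (((trivializationAt F V (b x)).linear ℝ hy).map_smul (c y) (v y)).symm

theorem Continuous.sub_totalSpace {v w : ∀ x, V (b x)}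
    (hv : Continuous fun x => TotalSpace.mk' F (b x) (v x))
    (hw : Continuous fun x => TotalSpace.mk' F (b x) (w x)) :
    Continuous fun x => TotalSpace.mk' F (b x) (v x - w x) := by
  have h := hv.add_totalSpace ((continuous_const (y := (-1 : ℝ))).smul_totalSpace hw)
  simpa only [neg_smul, one_smul, ← sub_eq_add_neg] using h

theorem Continuous.add_sum_totalSpace {ι : Type*} (s : Finset ι) {v : ∀ x, V (b x)}
    {w : ι → ∀ x, V (b x)} (hv : Continuous fun x => TotalSpace.mk' F (b x) (v x))
    (hw : ∀ i, Continuous fun x => TotalSpace.mk' F (b x) (w i x)) :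
    Continuous fun x => TotalSpace.mk' F (b x) (v x + ∑ i ∈ s, w i x) := by
  classical
  induction s using Finset.induction_on with
  | empty => simpa using hv
  | insert i s hi ih =>
    have h := ih.add_totalSpace (hw i)
    simpa only [Finset.sum_insert hi, add_comm (w i _), add_assoc] using h

end BundleContinuity

/-! ### Nowhere vanishing paths in one inner product space. -/

section SpherePaths

variable {E : Type*} [NormedAddCommGroup E] [InnerProductSpace ℝ E]

/-- A tent function of width `δ` centred at `c`. -/
noncomputable def tent (δ c s : ℝ) : ℝ := max 0 (1 - |s - c| / δ)

theorem tent_nonneg (δ c s : ℝ) : 0 ≤ tent δ c s := le_max_left _ _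

theorem tent_le_one {δ : ℝ} (hδ : 0 < δ) (c s : ℝ) : tent δ c s ≤ 1 :=
  max_le zero_le_one (sub_le_self _ (by positivity))

@[simp] theorem tent_self (δ c : ℝ) : tent δ c c = 1 := by simp [tent]

theorem abs_sub_lt_of_tent_ne_zero {δ c s : ℝ} (hδ : 0 < δ) (h : tent δ c s ≠ 0) :
    |s - c| < δ := by
  by_contra! hle
  refine h (max_eq_left ?_)
  rw [sub_nonpos, one_le_div hδ]
  exact hle

theorem tent_eq_zero_of_tent_ne_zero {δ c c' s : ℝ} (hδ : 0 < δ) (hc : 2 * δ ≤ |c - c'|)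
    (h : tent δ c s ≠ 0) : tent δ c' s = 0 := by
  by_contra h'
  have h1 := abs_sub_lt_of_tent_ne_zero hδ h
  have h2 := abs_sub_lt_of_tent_ne_zero hδ h'
  have h3 := abs_sub_le c s c'
  rw [abs_sub_comm c s] at h3
  linarith

@[fun_prop] theorem continuous_tent (δ c : ℝ) : Continuous (tent δ c) := by
  unfold tent
  fun_prop

/-- The broken line from `x` through `σ` and `-x` to `y`, bent outwards between `x` and `-x`. -/
noncomputable def detour (x σ y : E) (τ : ℝ) : E :=
  max (1 - 4 * τ) (2 * τ - 2) • x + max 0 (τ * (1 - 2 * τ)) • σ + max 0 (2 * τ - 1) • y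

theorem detour_zero (x σ y : E) : detour x σ y 0 = x := by
  have h : max (1 : ℝ) (-2) = 1 := by norm_num
  simp [detour, h]

theorem detour_one (x σ y : E) : detour x σ y 1 = y := by
  have h1 : max (1 - 4 * 1 : ℝ) (2 * 1 - 2) = 0 := by norm_num
  have h2 : max (0 : ℝ) (1 * (1 - 2 * 1)) = 0 := by norm_num
  have h3 : max (0 : ℝ) (2 * 1 - 1) = 1 := by norm_num
  simp only [detour, h1, h2, h3, zero_smul, one_smul, zero_add]

/-- For `τ ≤ 1/2` the `x`-coefficient vanishes only at `1/4`, where the `σ`-coefficient is `1/8`.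
Afterwards the curve is the segment from `-x` to `y`; comparing norms, it can vanish only at `3/4`,
and then `y = x`. -/
theorem detour_ne_zero {x σ y : E} (hx : ‖x‖ = 1) (hσ : ‖σ‖ = 1) (hxσ : inner ℝ x σ = 0)
    (hy : ‖y‖ = 1) (hxy : y ≠ x) {τ : ℝ} (h0 : 0 ≤ τ) (h1 : τ ≤ 1) : detour x σ y τ ≠ 0 := by
  intro h
  have hxx : inner ℝ x x = (1 : ℝ) := by rw [real_inner_self_eq_norm_sq, hx, one_pow]
  have hσσ : inner ℝ σ σ = (1 : ℝ) := by rw [real_inner_self_eq_norm_sq, hσ, one_pow]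
  rcases le_or_gt τ (1 / 2) with hτ | hτ
  · have e1 : max (1 - 4 * τ) (2 * τ - 2) = 1 - 4 * τ := max_eq_left (by linarith)
    have e2 : max 0 (τ * (1 - 2 * τ)) = τ * (1 - 2 * τ) :=
      max_eq_right (mul_nonneg h0 (by linarith))
    have e3 : max 0 (2 * τ - 1) = 0 := max_eq_left (by linarith)
    rw [detour, e1, e2, e3, zero_smul, add_zero] at h
    have hix := congrArg (inner ℝ x) h
    have hiσ := congrArg (inner ℝ σ) h
    rw [inner_add_right, inner_smul_right, inner_smul_right, inner_zero_right, hxx, hxσ] at hix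
    rw [inner_add_right, inner_smul_right, inner_smul_right, inner_zero_right, hσσ,
      real_inner_comm, hxσ] at hiσ
    have : τ = 1 / 4 := by linarith
    subst this
    norm_num at hiσ
  · have e1 : max (1 - 4 * τ) (2 * τ - 2) = -(2 - 2 * τ) := by
      rw [max_eq_right (by linarith)]; ring
    have e2 : max 0 (τ * (1 - 2 * τ)) = 0 := max_eq_left (by nlinarith)
    have e3 : max 0 (2 * τ - 1) = 2 * τ - 1 := max_eq_right (by linarith)
    rw [detour, e1, e2, e3, zero_smul, add_zero, neg_smul, neg_add_eq_zero] at h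
    have hn := congrArg norm h
    rw [norm_smul, norm_smul, hx, hy, Real.norm_of_nonneg (by linarith),
      Real.norm_of_nonneg (by linarith)] at hn
    have : τ = 3 / 4 := by linarith
    subst this
    norm_num at h
    exact hxy h.symm

theorem segment_ne_zero {x y : E} (hx : ‖x‖ = 1) (hy : ‖y‖ = 1) (hxy : y ≠ -x) {τ : ℝ}
    (h0 : 0 ≤ τ) (h1 : τ ≤ 1) : (1 - τ) • x + τ • y ≠ 0 := by
  intro h
  have h' := eq_neg_of_add_eq_zero_left h
  have hn := congrArg norm h'
  rw [norm_neg, norm_smul, norm_smul, hx, hy, Real.norm_of_nonneg (by linarith),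
    Real.norm_of_nonneg h0] at hn
  have : τ = 1 / 2 := by linarith
  subst this
  norm_num at h
  rw [← smul_add, smul_eq_zero] at h
  exact hxy (eq_neg_of_add_eq_zero_right (h.resolve_left (by norm_num)))

open Classical in
/-- A path from `x` to `y`: the detour through `σ` and `-x` if `P` holds, and the segment
otherwise. -/
noncomputable def leg (P : Prop) (x σ y : E) (τ : ℝ) : E :=
  if P then detour x σ y τ else (1 - τ) • x + τ • y

theorem leg_zero (P : Prop) (x σ y : E) : leg P x σ y 0 = x := by
  unfold leg
  split_ifs
  · exact detour_zero x σ y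
  · simp

theorem leg_one (P : Prop) (x σ y : E) : leg P x σ y 1 = y := by
  unfold leg
  split_ifs
  · exact detour_one x σ y
  · simp

theorem leg_ne_zero {P : Prop} {x σ y : E} (hx : ‖x‖ = 1) (hσ : ‖σ‖ = 1)
    (hxσ : inner ℝ x σ = 0) (hy : ‖y‖ = 1) (hP : P → y ≠ x) (hnP : ¬P → y ≠ -x) {τ : ℝ}
    (h0 : 0 ≤ τ) (h1 : τ ≤ 1) : leg P x σ y τ ≠ 0 := by
  unfold leg
  split_ifs with h
  · exact detour_ne_zero hx hσ hxσ hy (hP h) h0 h1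
  · exact segment_ne_zero hx hy (hnP h) h0 h1

variable {ι : Type*} [Fintype ι]

/-- The path based at `x` which, near the time `t j`, runs to `y j` along a leg and back. -/
noncomputable def tour (J : Finset ι) (δ : ℝ) (t : ι → ℝ) (x σ : E) (y : ι → E) (s : ℝ) : E :=
  x + ∑ j, (leg (j ∈ J) x σ (y j) (tent δ (t j) s) - x)

/-- Tents with centres `2 * δ` apart have disjoint supports, so every other leg rests at `x` and
contributes 0. -/
theorem tour_eq_leg {J : Finset ι} {δ : ℝ} (hδ : 0 < δ) {t : ι → ℝ}
    (ht : ∀ i j, i ≠ j → 2 * δ ≤ |t i - t j|) (x σ : E) (y : ι → E) {s : ℝ} {j : ι}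
    (hj : tent δ (t j) s ≠ 0) :
    tour J δ t x σ y s = leg (j ∈ J) x σ (y j) (tent δ (t j) s) := by
  rw [tour, Finset.sum_eq_single j, add_sub_cancel]
  · intro i _ hij
    rw [tent_eq_zero_of_tent_ne_zero hδ (ht j i hij.symm) hj, leg_zero, sub_self]
  · simp

theorem tour_apply_time {J : Finset ι} {δ : ℝ} (hδ : 0 < δ) {t : ι → ℝ}
    (ht : ∀ i j, i ≠ j → 2 * δ ≤ |t i - t j|) (x σ : E) (y : ι → E) (j : ι) :
    tour J δ t x σ y (t j) = y j := by
  rw [tour_eq_leg hδ ht x σ y (j := j) (by simp), tent_self, leg_one]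

theorem tour_ne_zero {J : Finset ι} {δ : ℝ} (hδ : 0 < δ) {t : ι → ℝ}
    (ht : ∀ i j, i ≠ j → 2 * δ ≤ |t i - t j|) {x σ : E} {y : ι → E} (hx : ‖x‖ = 1)
    (hσ : ‖σ‖ = 1) (hxσ : inner ℝ x σ = 0) (hy : ∀ j, ‖y j‖ = 1) (hJ : ∀ j ∈ J, y j ≠ x)
    (hnJ : ∀ j ∉ J, y j ≠ -x) (s : ℝ) : tour J δ t x σ y s ≠ 0 := by
  by_cases h : ∃ j, tent δ (t j) s ≠ 0
  · obtain ⟨j, hj⟩ := h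
    rw [tour_eq_leg hδ ht x σ y hj]
    exact leg_ne_zero hx hσ hxσ (hy j) (hJ j) (hnJ j) (tent_nonneg _ _ _) (tent_le_one hδ _ _)
  · push Not at h
    have hsum : tour J δ t x σ y s = x := by
      simp [tour, h, leg_zero]
    rw [hsum]
    rintro rfl
    simp at hx

theorem exists_pos_two_mul_le_abs_sub {t : ι → ℝ} (ht : Function.Injective t) :
    ∃ δ > 0, ∀ i j, i ≠ j → 2 * δ ≤ |t i - t j| := by
  have h : ∀ᶠ δ : ℝ in 𝓝[>] 0, ∀ i j, i ≠ j → 2 * δ ≤ |t i - t j| := by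
    refine Filter.eventually_all.2 fun i => Filter.eventually_all.2 fun j => ?_
    by_cases hij : i = j
    · simp [hij]
    · have hpos : 0 < |t i - t j| / 2 := half_pos (abs_sub_pos.2 (ht.ne hij))
      filter_upwards [nhdsWithin_le_nhds (Iio_mem_nhds hpos)] with δ hδ _
      have : δ < |t i - t j| / 2 := hδ
      linarith
  obtain ⟨δ, h1, h2⟩ := (h.and self_mem_nhdsWithin).exists
  exact ⟨δ, h2, h1⟩

end SpherePaths

/-! ### Merging a cover with a stratification by small values. -/

section ShiftedCover

variable {Y ι : Type*}

/-- The open set on which `J` is the set of indices of the smallest values of `g`, these values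
lie below `b`, and all others exceed `a`. -/
def smallValuesSet (g : ι → Y → ℝ) (a b : ℝ) (J : Finset ι) : Set Y :=
  {y | (∀ j ∈ J, g j y < b) ∧ (∀ j ∉ J, a < g j y) ∧ ∀ j ∈ J, ∀ l ∉ J, g j y < g l y}

theorem isOpen_smallValuesSet [TopologicalSpace Y] [Finite ι] {g : ι → Y → ℝ}
    (hg : ∀ j, Continuous (g j)) (a b : ℝ)
    (J : Finset ι) : IsOpen (smallValuesSet g a b J) := by
  have h : smallValuesSet g a b J = (⋂ j, ⋂ (_ : j ∈ J), {y | g j y < b}) ∩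
      ((⋂ j, ⋂ (_ : j ∉ J), {y | a < g j y}) ∩
        ⋂ j, ⋂ (_ : j ∈ J), ⋂ l, ⋂ (_ : l ∉ J), {y | g j y < g l y}) := by
    ext y
    simp [smallValuesSet]
  rw [h]
  refine IsOpen.inter ?_ (IsOpen.inter ?_ ?_)
  · exact isOpen_iInter_of_finite fun j => isOpen_iInter_of_finite fun _ =>
      isOpen_lt (hg j) continuous_const
  · exact isOpen_iInter_of_finite fun j => isOpen_iInter_of_finite fun _ =>
      isOpen_lt continuous_const (hg j)
  · exact isOpen_iInter_of_finite fun j => isOpen_iInter_of_finite fun _ =>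
      isOpen_iInter_of_finite fun l => isOpen_iInter_of_finite fun _ => isOpen_lt (hg j) (hg l)

theorem mem_smallValuesSet_filter [Fintype ι] (g : ι → Y → ℝ) {a b : ℝ} (hab : a < b) (y : Y) :
    y ∈ smallValuesSet g a b {j | g j y < b} := by
  refine ⟨by simp, fun j hj => ?_, fun j hj l hl => ?_⟩ <;> simp at * <;> linarith

/-- Distinct sets of equal size each have an element outside the other, and the two values would
each be smaller than the other. -/
theorem eq_of_mem_smallValuesSet {g : ι → Y → ℝ} {a b : ℝ} {J J' : Finset ι}
    (hcard : J.card = J'.card) {y : Y} (h : y ∈ smallValuesSet g a b J)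
    (h' : y ∈ smallValuesSet g a b J') : J = J' := by
  by_contra hne
  have h1 : ¬J ⊆ J' := fun hs => hne (Finset.eq_of_subset_of_card_le hs hcard.ge)
  have h2 : ¬J' ⊆ J := fun hs => hne (Finset.eq_of_subset_of_card_le hs hcard.le).symm
  obtain ⟨j, hj, hj'⟩ := Finset.not_subset.1 h1
  obtain ⟨l, hl', hl⟩ := Finset.not_subset.1 h2
  exact lt_asymm (h.2.2 j hj l hl) (h'.2.2 l hl' j hj')

theorem subset_of_mem_smallValuesSet {g : ι → Y → ℝ} {a b a' b' : ℝ} (hb : b ≤ a')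
    {J J' : Finset ι} {y : Y} (h : y ∈ smallValuesSet g a b J)
    (h' : y ∈ smallValuesSet g a' b' J') : J ⊆ J' := by
  intro j hj
  by_contra hj'
  linarith [h.1 j hj, h'.2.1 j hj']

/-- An arbitrary open cover `U 0, …, U k` combined with a family of functions of which at most `m`
can be small at the same time yields an open cover by `k + m + 1` sets carrying sections, provided
sections exist over the intersections. No separation property of `Y` is used. -/
theorem secat_le_of_smallValuesSet {X : Type*} [TopologicalSpace X]
    [TopologicalSpace Y] {p : X → Y} [Fintype ι]
    {g : ι → Y → ℝ} (hg : ∀ j, Continuous (g j)) {k m : ℕ} {U : Fin (k + 1) → Set Y}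
    (hU : ∀ i, IsOpen (U i)) (hcov : (⋃ i, U i) = Set.univ)
    (hm : ∀ y b, b ≤ 1 → (({j | g j y < b} : Finset ι)).card ≤ m)
    (hsec : ∀ i a b (J : Finset ι), 0 ≤ a → b ≤ 1 →
      HasSectionOver p (U i ∩ smallValuesSet g a b J)) :
    secat p ≤ ((k + m : ℕ) : ℕ∞) := by
  -- The windows from `c i` to `c (i + 1)`, for `i ≤ k`, cut `[0, 1]` into consecutive intervals.
  let c : ℕ → ℝ := fun i => i / (k + 1)
  have hc : ∀ i : ℕ, i ≤ k + 1 → c i ≤ 1 := fun i hi => by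
    have : (i : ℝ) ≤ k + 1 := by exact_mod_cast hi
    exact div_le_one_of_le₀ this (by positivity)
  have hmono : Monotone c := fun i j hij => by
    have : (i : ℝ) ≤ j := by exact_mod_cast hij
    exact div_le_div_of_nonneg_right this (by positivity)
  let A (n : ℕ) := {q : Fin (k + 1) × Finset ι // (q.1 : ℕ) + q.2.card = n}
  let S (q : Fin (k + 1) × Finset ι) : Set Y :=
    U q.1 ∩ smallValuesSet g (c q.1) (c (q.1 + 1)) q.2
  have hSopen : ∀ q, IsOpen (S q) := fun q =>
    (hU q.1).inter (isOpen_smallValuesSet hg _ _ _)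
  -- A higher window can only enlarge `J`, so on overlapping pieces a larger `i` makes `i + |J|`
  -- strictly larger.
  have hcard : ∀ q q' : Fin (k + 1) × Finset ι, ∀ y, y ∈ S q → y ∈ S q' → q.1 < q'.1 →
      q.2.card ≤ q'.2.card := fun q q' y hy hy' hlt =>
    Finset.card_le_card (subset_of_mem_smallValuesSet (hmono hlt) hy.2 hy'.2)
  refine secat_le_of_cover (fun n => ⋃ q : A n, S q.1)
    (fun n => isOpen_iUnion fun q => hSopen _) ?_ fun n =>
      HasSectionOver.iUnion_of_pairwise_disjoint (fun q => hSopen _) ?_ fun q =>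
        hsec _ _ _ _ (by positivity) (hc _ q.1.1.2)
  · refine Set.eq_univ_of_forall fun y => ?_
    obtain ⟨i, hi⟩ := Set.mem_iUnion.1 (hcov ▸ Set.mem_univ y)
    have hJ := mem_smallValuesSet_filter g (a := c i) (b := c (i + 1)) (by
      simp only [c]
      gcongr
      simp) y
    have hJm := hm y (c (i + 1)) (hc _ i.2)
    refine Set.mem_iUnion.2 ⟨⟨i + ({j | g j y < c (i + 1)} : Finset ι).card, by omega⟩,
      Set.mem_iUnion.2 ⟨⟨(i, _), rfl⟩, hi, hJ⟩⟩
  · rintro ⟨q, hq⟩ ⟨q', hq'⟩ hne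
    have hqq : (q.1 : ℕ) + q.2.card = q'.1 + q'.2.card := hq.trans hq'.symm
    refine Set.disjoint_left.2 fun y hy hy' => hne (Subtype.ext ?_)
    rcases lt_trichotomy q.1 q'.1 with hlt | heq | hgt
    · have := hcard q q' y hy hy' hlt
      have : (q.1 : ℕ) < q'.1 := hlt
      omega
    · refine Prod.ext heq ?_
      have hy1 : y ∈ smallValuesSet g (c q.1) (c (q.1 + 1)) q.2 := hy.2
      have hy2 : y ∈ smallValuesSet g (c q'.1) (c (q'.1 + 1)) q'.2 := hy'.2
      rw [← heq] at hy2 hqq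
      exact eq_of_mem_smallValuesSet (Nat.add_left_cancel hqq) hy1 hy2
    · have := hcard q' q y hy' hy hgt
      have : (q'.1 : ℕ) < q.1 := hgt
      omega

end ShiftedCover

/-! ### Tours carried out continuously over the sphere bundle. -/

section SphereBundles

variable {B F : Type*} {V : B → Type*} [∀ b, NormedAddCommGroup (V b)]

/-- The vectors of a point of the fibre power of the unit sphere bundle, in one common fibre. -/
theorem FiberPower.exists_vec {r : ℕ} (w : FiberPower (unitSphereProj F V) r) (i j : Fin r) :
    ∃ v : V (w.1 i).1.proj, TotalSpace.mk' F (w.1 i).1.proj v = (w.1 j).1 := by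
  have h : (w.1 j).1.proj = (w.1 i).1.proj := w.2 j i
  generalize (w.1 j).1 = e at h
  rw [← h]
  exact ⟨e.2, rfl⟩

theorem FiberPower.continuous_apply {X Y : Type*} [TopologicalSpace X] {p : X → Y} {r : ℕ}
    (j : Fin r) : Continuous fun w : FiberPower p r => w.1 j :=
  (_root_.continuous_apply j).comp continuous_subtype_val

theorem norm_eq_one_of_mk_eq {e : UnitSphereBundle F V} {b : B} {v : V b}
    (h : TotalSpace.mk' F b v = e.1) : ‖v‖ = 1 := by
  have h' := e.2
  rwa [← h] at h'

variable [∀ b, InnerProductSpace ℝ (V b)]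

theorem StiefelBundle.exists_vec (z : StiefelBundle F V) {b : B} {v : V b}
    (h : TotalSpace.mk' F b v = z.1.1.1) :
    ∃ σ : V b, TotalSpace.mk' F b σ = z.1.2.1 ∧ inner ℝ v σ = 0 := by
  obtain ⟨b', v', σ, h1, h2, h3⟩ := z.2
  rw [h1] at h
  cases h
  exact ⟨σ, h2.symm, h3⟩

variable [TopologicalSpace B] [TopologicalSpace (TotalSpace F V)]
  [NormedAddCommGroup F] [NormedSpace ℝ F] [FiberBundle F V] [VectorBundle ℝ F V]

theorem Continuous.leg_totalSpace {X : Type*} [TopologicalSpace X] {b : X → B}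
    {v σ y : ∀ x, V (b x)} {τ : X → ℝ} (P : Prop)
    (hv : Continuous fun x => TotalSpace.mk' F (b x) (v x))
    (hσ : Continuous fun x => TotalSpace.mk' F (b x) (σ x))
    (hy : Continuous fun x => TotalSpace.mk' F (b x) (y x)) (hτ : Continuous τ) :
    Continuous fun x => TotalSpace.mk' F (b x) (leg P (v x) (σ x) (y x) (τ x)) := by
  unfold leg detour
  split_ifs
  · refine ((Continuous.smul_totalSpace ?_ hv).add_totalSpace
      (Continuous.smul_totalSpace ?_ hσ)).add_totalSpace (Continuous.smul_totalSpace ?_ hy) <;>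
    fun_prop
  · refine (Continuous.smul_totalSpace ?_ hv).add_totalSpace (Continuous.smul_totalSpace ?_ hy) <;>
    fun_prop

theorem Continuous.tour_totalSpace {X ι : Type*} [TopologicalSpace X] [Fintype ι] {b : X → B}
    {v σ : ∀ x, V (b x)} {y : ∀ x, ι → V (b x)} {s : X → ℝ} (J : Finset ι) (δ : ℝ) (t : ι → ℝ)
    (hv : Continuous fun x => TotalSpace.mk' F (b x) (v x))
    (hσ : Continuous fun x => TotalSpace.mk' F (b x) (σ x))
    (hy : ∀ j, Continuous fun x => TotalSpace.mk' F (b x) (y x j)) (hs : Continuous s) :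
    Continuous fun x => TotalSpace.mk' F (b x) (tour J δ t (v x) (σ x) (y x) (s x)) :=
  hv.add_sum_totalSpace _ fun j => Continuous.sub_totalSpace
    (hv.leg_totalSpace _ hσ (hy j) ((continuous_tent δ (t j)).comp hs)) hv

variable [IsContinuousRiemannianBundle F V]

/-- Normalizing a nowhere vanishing continuous family of vectors gives a continuous map to the
unit sphere bundle. -/
theorem Continuous.normalize_totalSpace {X : Type*} [TopologicalSpace X] {b : X → B}
    {v : ∀ x, V (b x)} (hv : Continuous fun x => TotalSpace.mk' F (b x) (v x))
    (hne : ∀ x, v x ≠ 0) : Continuous fun x =>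
      (⟨TotalSpace.mk' F (b x) (‖v x‖⁻¹ • v x), norm_smul_inv_norm (𝕜 := ℝ) (hne x)⟩ :
        UnitSphereBundle F V) := by
  have hnorm : Continuous fun x => ‖v x‖ := by
    have h : Continuous fun x => √(Inner.inner ℝ (v x) (v x)) := (hv.inner_bundle hv).sqrt
    simpa only [← norm_eq_sqrt_real_inner] using h
  exact ((hnorm.inv₀ fun x => norm_ne_zero_iff.2 (hne x)).smul_totalSpace hv).subtype_mk _

/-- Continuous families of tours give a section of the evaluation map. -/
theorem hasSectionOver_evalAtTimes_of_tour {r : ℕ} {t : Fin r → unitInterval}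
    (ht : Function.Injective t) (W : Set (FiberPower (unitSphereProj F V) r)) (J : Finset (Fin r))
    (b : W → B) (v σ : ∀ w, V (b w)) (y : ∀ w, Fin r → V (b w))
    (hv : Continuous fun w => TotalSpace.mk' F (b w) (v w))
    (hσ : Continuous fun w => TotalSpace.mk' F (b w) (σ w))
    (hy : ∀ w j, TotalSpace.mk' F (b w) (y w j) = (w.1.1 j).1)
    (hv1 : ∀ w, ‖v w‖ = 1) (hσ1 : ∀ w, ‖σ w‖ = 1) (hvσ : ∀ w, inner ℝ (v w) (σ w) = 0)
    (hJ : ∀ w, ∀ j ∈ J, y w j ≠ v w) (hnJ : ∀ w, ∀ j ∉ J, y w j ≠ -v w) :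
    HasSectionOver (evalAtTimes (unitSphereProj F V) t) W := by
  obtain ⟨δ, hδ, hsep⟩ := exists_pos_two_mul_le_abs_sub
    (t := fun j => (t j : ℝ)) (Subtype.val_injective.comp ht)
  have hyc : ∀ j, Continuous fun w => TotalSpace.mk' F (b w) (y w j) := fun j => by
    simp only [hy]
    exact continuous_subtype_val.comp
      ((FiberPower.continuous_apply j).comp continuous_subtype_val)
  have hy1 : ∀ w j, ‖y w j‖ = 1 := fun w j => norm_eq_one_of_mk_eq (hy w j)
  have hne : ∀ x : W × unitInterval, tour J δ (fun j => (t j : ℝ)) (v x.1) (σ x.1) (y x.1) x.2 ≠ 0 :=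
    fun x => tour_ne_zero hδ hsep (hv1 _) (hσ1 _) (hvσ _) (hy1 _) (hJ _) (hnJ _) _
  let Φ : C(W × unitInterval, UnitSphereBundle F V) := ⟨_, Continuous.normalize_totalSpace
    (b := fun x : W × unitInterval => b x.1) (Continuous.tour_totalSpace J δ (fun j => (t j : ℝ))
      (hv.comp continuous_fst) (hσ.comp continuous_fst) (fun j => (hyc j).comp continuous_fst)
      (continuous_subtype_val.comp continuous_snd)) hne⟩
  -- Currying gives continuity for the compact-open topology; each path stays over `b w` by
  -- construction.
  refine ⟨⟨fun w => ⟨Φ.curry w, fun _ _ => rfl⟩, Φ.curry.continuous.subtype_mk _⟩, fun w => ?_⟩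
  refine Subtype.ext (funext fun j => Subtype.ext ?_)
  rw [← hy w j]
  change TotalSpace.mk' F (b w) (‖tour J δ (fun j => (t j : ℝ)) (v w) (σ w) (y w) (t j)‖⁻¹ •
    tour J δ (fun j => (t j : ℝ)) (v w) (σ w) (y w) (t j)) = _
  rw [tour_apply_time hδ hsep (v w) (σ w) (y w) j, hy1, inv_one, one_smul]

end SphereBundles

/-! ### The inequality. -/

theorem proposition4p1 {B : Type*} [TopologicalSpace B]
    (F : Type*) [NormedAddCommGroup F] [NormedSpace ℝ F] [FiniteDimensional ℝ F]
    (V : B → Type*) [TopologicalSpace (TotalSpace F V)]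
    [∀ b, NormedAddCommGroup (V b)] [∀ b, InnerProductSpace ℝ (V b)]
    [FiberBundle F V] [VectorBundle ℝ F V] [IsContinuousRiemannianBundle F V]
    (r : ℕ) (hr : 2 ≤ r) (t : Fin r → unitInterval) (ht : StrictMono t) :
    sequentialParamTC (unitSphereProj F V) t ≤ secat (stiefelProj F V) + ((r - 1 : ℕ) : ℕ∞) := by
  by_cases htop : secat (stiefelProj F V) = ⊤
  · simp [htop]
  obtain ⟨k, hk, U, hU, hcov, hsec⟩ := exists_cover_of_secat_ne_top htop
  rw [hk, ← Nat.cast_add]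
  let o : Fin r := ⟨0, by omega⟩
  -- All vectors are moved to the fibre under the first one, so that their inner products make
  -- sense. The choice is harmless, since `hy` fixes their images in the total space.
  choose y hy using fun w : FiberPower (unitSphereProj F V) r => w.exists_vec o
  have hyc : ∀ j, Continuous fun w : FiberPower (unitSphereProj F V) r =>
      TotalSpace.mk' F (w.1 o).1.proj (y w j) := fun j => by
    simp only [hy]
    exact continuous_subtype_val.comp (FiberPower.continuous_apply j)
  have hy1 : ∀ w j, ‖y w j‖ = 1 := fun w j => norm_eq_one_of_mk_eq (hy w j)
  have hyy : ∀ w j, inner ℝ (y w j) (y w j) = (1 : ℝ) := fun w j => by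
    rw [real_inner_self_eq_norm_sq, hy1, one_pow]
  refine secat_le_of_smallValuesSet (g := fun j w => 1 + inner ℝ (y w o) (y w j))
    (U := fun i => (fun w => w.1 o) ⁻¹' U i)
    (fun j => continuous_const.add ((hyc o).inner_bundle (hyc j)))
    (fun i => (hU i).preimage (FiberPower.continuous_apply o)) ?_ ?_ ?_
  · rw [← Set.preimage_iUnion, hcov, Set.preimage_univ]
  · intro w b hb
    -- The function of index `o` is constantly `2`, hence never small: this gives `r - 1` instead of
    -- `r`.
    have ho : o ∉ ({j | 1 + inner ℝ (y w o) (y w j) < b} : Finset (Fin r)) := by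
      rw [Finset.mem_filter_univ, hyy]
      linarith
    have := Finset.card_lt_univ_of_notMem ho
    rw [Fintype.card_fin] at this
    omega
  · intro i a b J ha hb
    obtain ⟨s, hs⟩ := hsec i
    set W : Set (FiberPower (unitSphereProj F V) r) := _ ∩ smallValuesSet _ a b J
    have hb' : ∀ w : W, TotalSpace.mk' F (w.1.1 o).1.proj (y w o) =
        (s ⟨w.1.1 o, w.2.1⟩).1.1.1 := fun w =>
      (hy w o).trans (congrArg Subtype.val (hs ⟨w.1.1 o, w.2.1⟩)).symm
    choose σ hσ hyσ using fun w : W => (s ⟨w.1.1 o, w.2.1⟩).exists_vec (hb' w)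
    refine hasSectionOver_evalAtTimes_of_tour ht.injective W J (fun w => (w.1.1 o).1.proj)
      (fun w => y w o) σ (fun w => y w) ((hyc o).comp continuous_subtype_val) ?_
      (fun w => hy w) (fun w => hy1 w o) (fun w => norm_eq_one_of_mk_eq (hσ w)) hyσ ?_ ?_
    · simp only [hσ]
      exact continuous_subtype_val.comp (continuous_snd.comp (continuous_subtype_val.comp
        (s.continuous.comp (((FiberPower.continuous_apply o).comp
          continuous_subtype_val).subtype_mk _))))
    -- If `y w j` were the base vector, its value would be `2`, not below `b ≤ 1`; in the next case
    -- `-y w o` would give `0`, not above `a ≥ 0`.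
    · intro w j hj h
      have : 1 + inner ℝ (y w o) (y w j) < b := w.2.2.1 j hj
      rw [h, hyy] at this
      linarith
    · intro w j hj h
      have : a < 1 + inner ℝ (y w o) (y w j) := w.2.2.2.1 j hj
      rw [h, inner_neg_right, hyy] at this
      linarith
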